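/- Let $(M,g,\nabla,\tau_g,\uparrow)$ be a Riemann--Cartan spacetime: $M$ is a smooth real four-dimensional, connected, paracompact (Hausdorff), noncompact manifold, $g$ a smooth metric of signature $(1,3)$, $\tau_g$ a volume form orienting $M$, $\uparrow$ a time orientation, and $\nabla$ a smooth linear connection on $M$ with $\nabla g=0$ (its torsion and curvature are arbitrary). Let $\mathbb{R}_{1,3}$ be the Clifford algebra of Minkowski space $\mathbb{R}^{1,3}$ (with $v^2=\eta(v,v)$, $\eta=\mathrm{diag}(1,-1,-1,-1)$), and let $(E_a)_{a=0,\dots,3}$ be the canonical basis of $\mathbb{R}^{1,3}$ and $(E_I)$, $I\subseteq\{0,1,2,3\}$, the basis of $\mathbb{R}_{1,3}$ formed by the ordered products of the $E_a$. Let $\mathrm{Spin}^e_{1,3}=\{a\in\mathbb{R}_{1,3}^0: a\tilde a=1\}$, where $\mathbb{R}_{1,3}^0$ is the even subalgebra and $\tilde a$ the reversion of $a$. Suppose that $M$ has a spin structure, i.e. a principal $\mathrm{Spin}^e_{1,3}$-bundle $P\to M$ with a smooth fibre preserving map $s$ to the bundle of oriented, time oriented orthonormal frames with $s(pu)=s(p)\mathrm{Ad}_u$,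 where a frame at $x$ is regarded as an isometry $\mathbb{R}^{1,3}\to T_xM$. Identify the Clifford bundle $\mathcal{C}\ell(M,g)=\bigcup_x\mathcal{C}\ell(T_xM,g_x)$ with the associated bundle $P\times_{\mathrm{Ad}}\mathbb{R}_{1,3}$, the class $[(p,a)]$ being the image of $a$ under the algebra isomorphism $\mathbb{R}_{1,3}\to\mathcal{C}\ell(T_xM,g_x)$ induced by $s(p)$. Let $\Gamma_p:T_xM\to T_pP$ be the spin connection, i.e. the smooth principal connection on $P$ that is the lift of $\nabla$: $s$ maps every curve in $P$ that is parallel for $\Gamma$ to a curve of orthonormal frames that is parallel for $\nabla$. For a smooth Clifford field $A\in\sec\mathcal{C}\ell(M,g)$ and a smooth vector field $V\in\sec TM$, the covariant derivative $\nabla_VA$ is defined at $x_0\in M$ by $$(\nabla_VA)(x_0)=\lim_{t\to0}\frac1t\left(A^0_{\parallel t}-A(x_0)\right),$$ where $\sigma$ is a curve with $\sigma(0)=x_0$, $\dot\sigma(0)=V(x_0)$ and $A^0_{\parallel t}=[(p(0),a)]$ is the parallel transport of $A(\sigma(t))=[(p(t),a)]$ from $\sigma(t)$ to $x_0$, $p$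 being a parallel lift of $\sigma$ to $P$ ($\dot p=\Gamma_p(\dot\sigma)$). Let $\Xi$ be a spin frame, i.e. a smooth global section of $P$, and put $e_a=[(\Xi,E_a)]$ and $e_I=[(\Xi,E_I)]$, so that $(e_a)$ is the orthonormal frame $s(\Xi)$. Let $e^a=\eta^{ab}e_b$, and write $V=V^ae_a$ and $A=A^Ie_I$. Then through every $p_0\in P$ over $x_0$ there is a parallel curve $p$, with $p(0)=p_0$, whose projection $\sigma$ has $\dot\sigma(0)=V(x_0)$; the above limit exists and has the same value for all parallel curves $p$ with $\sigma(0)=x_0$ and $\dot\sigma(0)=V(x_0)$; and $$\nabla_VA=V(A)+\tfrac12[\omega_V,A],\qquad V(A):=V(A^I)\,e_I,\qquad \omega_V=-\tfrac12V^a\Gamma_{abc}\,e^b\wedge e^c,$$ where the connection coefficients $\Gamma_{abc}$ are given by $\nabla_{e_a}e_b=\Gamma_{ab}{}^ce_c=\Gamma_{abc}e^c$, and $[\cdot,\cdot]$ is the commutator in the Clifford algebra. -/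

import Mathlib

open Bundle Filter Topology
open scoped Manifold ContDiff

noncomputable section

namespace RiemannCartan

/-! ### The Minkowski space `ℝ^{1,3}`, its Clifford algebra and the spin group -/

/-- The diagonal entries of the Minkowski form `η = diag(1, -1, -1, -1)`. -/
def eta : Fin 4 → ℝ := ![1, -1, -1, -1]

/-- The quadratic form of the vector Minkowski space `ℝ^{1,3}`. -/
def Q13 : QuadraticForm ℝ (Fin 4 → ℝ) := QuadraticMap.weightedSumSquares ℝ eta

/-- The real Clifford algebra `ℝ_{1,3}`, with `v² = Q13 v`. -/
abbrev R13 : Type := CliffordAlgebra Q13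

/-- The canonical orthonormal basis `E_a` of `ℝ^{1,3}`. -/
def stdVec (a : Fin 4) : Fin 4 → ℝ := Pi.single a 1

/-- The multivector basis `E_I` of `ℝ_{1,3}`: for `I = {a₁ < ⋯ < a_k}` it is
`E_{a₁} ∧ ⋯ ∧ E_{a_k}`, which for the orthonormal vectors `E_a` is the Clifford product
`E_{a₁} ⋯ E_{a_k}` (see `multivectorBasis_apply`). -/
def multivectorBasis : Module.Basis (Finset (Fin 4)) ℝ R13 :=
  (Pi.basisFun ℝ (Fin 4)).ExteriorAlgebra.map (CliffordAlgebra.equivExterior Q13).symm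

/-- Contraction annihilates products of vectors that are in the kernel of the linear form. -/
theorem contractLeft_prod_eq_zero {R M : Type*} [CommRing R] [AddCommGroup M] [Module R M]
    (Q : QuadraticForm R M) (d : Module.Dual R M) (l : List M) (h : ∀ v ∈ l, d v = 0) :
    CliffordAlgebra.contractLeft d ((l.map (CliffordAlgebra.ι Q)).prod) = 0 := by
  induction l with
  | nil => simp
  | cons v l ih =>
    rw [List.map_cons, List.prod_cons, CliffordAlgebra.contractLeft_ι_mul,
      ih (fun w hw => h w (List.mem_cons_of_mem _ hw)), h v List.mem_cons_self]
    simp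

theorem equivExterior_prod (l : List (Fin 4)) (hl : l.Nodup) :
    CliffordAlgebra.equivExterior Q13
      ((l.map (fun a => CliffordAlgebra.ι Q13 (stdVec a))).prod)
      = (l.map (fun a => ExteriorAlgebra.ι ℝ (stdVec a))).prod := by
  induction l with
  | nil => simp
  | cons a l ih =>
    rw [List.nodup_cons] at hl
    have ih' := ih hl.2
    rw [CliffordAlgebra.equivExterior, CliffordAlgebra.changeFormEquiv_apply] at ih' ⊢
    rw [List.map_cons, List.prod_cons, List.map_cons, List.prod_cons,
      CliffordAlgebra.changeForm_ι_mul, ih']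
    have h0 := contractLeft_prod_eq_zero (0 : QuadraticForm ℝ (Fin 4 → ℝ))
      ((QuadraticMap.associated (R := ℝ) (-Q13)) (stdVec a)) (l.map stdVec) (by
        intro v hv
        obtain ⟨b, hb, rfl⟩ := List.mem_map.1 hv
        have hab : a ≠ b := fun h => hl.1 (h ▸ hb)
        simp only [neg_apply, QuadraticMap.associated_apply, Q13,
          QuadraticMap.weightedSumSquares_apply, stdVec, Pi.add_apply]
        fin_cases a <;> fin_cases b <;> simp_all [Fin.sum_univ_four, Pi.single_apply])
    rw [List.map_map] at h0
    erw [h0]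
    rw [sub_zero]

/-- `E_I = E_{a₁} ⋯ E_{a_k}` for `I = {a₁ < ⋯ < a_k}`. -/
theorem multivectorBasis_apply (I : Finset (Fin 4)) :
    multivectorBasis I = (I.sort.map (fun a => CliffordAlgebra.ι Q13 (stdVec a))).prod := by
  rw [multivectorBasis, Module.Basis.map_apply, LinearEquiv.symm_apply_eq,
    equivExterior_prod _ (Finset.sort_nodup _ _), ExteriorAlgebra.basis_apply]
  trans ExteriorAlgebra.ιMulti ℝ I.card ((Pi.basisFun ℝ (Fin 4)) ∘ I.orderEmbOfFin rfl)
  · rfl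
  rw [ExteriorAlgebra.ιMulti_apply, ← Finset.listMap_orderEmbOfFin_finRange I rfl, List.map_map,
    List.ofFn_eq_map]
  congr 1
  refine List.map_congr_left fun i _ => ?_
  simp only [Function.comp_apply, Pi.basisFun_apply]
  rfl

/-- `Spin^e_{1,3} = {a ∈ ℝ⁰_{1,3} : a ã = 1}`, where `ã` is the reversion of `a`. -/
def Spin13 : Subgroup R13ˣ where
  carrier := {u | (u : R13) ∈ CliffordAlgebra.even Q13 ∧
    (u : R13) * CliffordAlgebra.reverse (u : R13) = 1}
  one_mem' := by
    refine ⟨?_, ?_⟩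
    · simp
    · simp
  mul_mem' := by
    rintro a b ⟨ha, ha'⟩ ⟨hb, hb'⟩
    refine ⟨?_, ?_⟩
    · simpa using Subalgebra.mul_mem _ ha hb
    · rw [Units.val_mul, CliffordAlgebra.reverse.map_mul,
        show (a : R13) * b * (CliffordAlgebra.reverse (b : R13) * CliffordAlgebra.reverse (a : R13))
          = a * (b * CliffordAlgebra.reverse (b : R13)) * CliffordAlgebra.reverse (a : R13) by
          simp only [mul_assoc], hb', mul_one, ha']
  inv_mem' := by
    rintro a ⟨ha, ha'⟩
    have h : ((a⁻¹ : R13ˣ) : R13) = CliffordAlgebra.reverse (a : R13) := by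
      rw [Units.inv_eq_of_mul_eq_one_right ha']
    refine ⟨?_, ?_⟩
    · rw [h]
      have hr := (CliffordAlgebra.reverse_mem_evenOdd_iff (Q := Q13) (n := 0) (x := (a : R13))).2 ha
      exact hr
    · rw [h, CliffordAlgebra.reverse_reverse, ← h, Units.inv_mul]

/-! ### Riemann–Cartan spacetimes -/

section Spacetime

variable (M : Type*) [TopologicalSpace M] [ChartedSpace (EuclideanSpace ℝ (Fin 4)) M]

/-- Vector fields on `M`. -/
abbrev VectorField : Type _ := ∀ x : M, TangentSpace (𝓡 4) x

variable {M}

/-- `X` is a smooth section of `TM`. -/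
def IsSmoothVectorField [IsManifold (𝓡 4) ∞ M] (X : VectorField M) : Prop :=
  ContMDiff (𝓡 4) (𝓡 4).tangent ∞ (fun x => (⟨x, X x⟩ : TangentBundle (𝓡 4) M))

/-- The quadratic form `v ↦ b(v, v)` on a tangent space. -/
def quadOf {x : M} (b : TangentSpace (𝓡 4) x →L[ℝ] TangentSpace (𝓡 4) x →L[ℝ] ℝ) :
    QuadraticForm ℝ (TangentSpace (𝓡 4) x) :=
  LinearMap.BilinMap.toQuadraticMap b.toLinearMap₁₂

variable (M) [IsManifold (𝓡 4) ∞ M]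

/-- The data `(g, ∇, τ_g, ↑)` of a Riemann–Cartan spacetime with underlying manifold `M`. No
condition is put on the torsion or on the curvature of `∇`. -/
structure Spacetime where
  /-- the metric `g` -/
  metric : ∀ x : M, TangentSpace (𝓡 4) x →L[ℝ] TangentSpace (𝓡 4) x →L[ℝ] ℝ
  metric_symm : ∀ x v w, metric x v w = metric x w v
  metric_smooth : ContMDiff (𝓡 4)
    ((𝓡 4).prod 𝓘(ℝ, EuclideanSpace ℝ (Fin 4) →L[ℝ] EuclideanSpace ℝ (Fin 4) →L[ℝ] ℝ)) ∞
    (fun x => TotalSpace.mk'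
      (EuclideanSpace ℝ (Fin 4) →L[ℝ] EuclideanSpace ℝ (Fin 4) →L[ℝ] ℝ)
      (E := fun x : M => TangentSpace (𝓡 4) x →L[ℝ] TangentSpace (𝓡 4) x →L[ℝ] ℝ) x (metric x))
  /-- the metric has signature `(1,3)` -/
  metric_signature : ∀ x, Nonempty (Q13.IsometryEquiv (quadOf (metric x)))
  /-- the linear connection `∇`; `conn X x v` is `(∇_v X)(x)` -/
  conn : CovariantDerivative (𝓡 4) (EuclideanSpace ℝ (Fin 4)) (TangentSpace (𝓡 4) : M → Type _)
  conn_smooth : conn.ContMDiffCovariantDerivative ∞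
  /-- `∇ g = 0` -/
  conn_metric : ∀ X Y : VectorField M, IsSmoothVectorField X → IsSmoothVectorField Y →
    ∀ (x : M) (v : TangentSpace (𝓡 4) x),
      mvfderiv (𝓡 4) (fun y => metric y (X y) (Y y)) x v
        = metric x (conn X x v) (Y x) + metric x (X x) (conn Y x v)
  /-- the metric volume form `τ_g`, which orients `M` -/
  vol : ∀ x : M, TangentSpace (𝓡 4) x [⋀^Fin 4]→ₗ[ℝ] ℝ
  vol_smooth : ∀ X : Fin 4 → VectorField M, (∀ i, IsSmoothVectorField (X i)) →
    ContMDiff (𝓡 4) 𝓘(ℝ, ℝ) ∞ (fun x => vol x (fun i => X i x))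
  vol_metric : ∀ (x : M) (f : Q13.IsometryEquiv (quadOf (metric x))),
    |vol x (fun a => f (stdVec a))| = 1
  /-- the time orientation: the future pointing timelike vectors -/
  future : ∀ x : M, TangentSpace (𝓡 4) x → Prop
  future_spec : ∀ x₀ : M, ∃ X : VectorField M, IsSmoothVectorField X ∧ ∀ᶠ x in 𝓝 x₀,
    0 < metric x (X x) (X x) ∧
      ∀ v, future x v ↔ 0 < metric x v v ∧ 0 < metric x (X x) v

variable {M}

namespace Spacetime

variable (S : Spacetime M)

/-- The quadratic form `g_x(v, v)` on `T_x M`. -/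
abbrev quad (x : M) : QuadraticForm ℝ (TangentSpace (𝓡 4) x) := quadOf (S.metric x)

/-- The fibre `Cℓ(T_x M, g_x)` of the Clifford bundle `Cℓ(M, g)`. -/
abbrev Cl (x : M) : Type _ := CliffordAlgebra (S.quad x)

/-- The fibre over `x` of the bundle of oriented and time oriented orthonormal frames. The frame
`e_a` is regarded as the isometry `ℝ^{1,3} → T_x M` that sends `E_a` to `e_a`. -/
structure LorentzFrame (x : M) where
  iso : Q13.IsometryEquiv (S.quad x)
  oriented : 0 < S.vol x (fun a => iso (stdVec a))
  timeOriented : S.future x (iso (stdVec 0))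

/-- The vector field `Y` along the curve `σ` satisfies `DY/dt = 0` at `t₀`: whenever
`Y = ∑ fⁱ Xᵢ` near `t₀`, one has `∑ (ḟⁱ Xᵢ + fⁱ ∇_{σ̇} Xᵢ) = 0` at `t₀`. -/
def IsParallelAt (σ : ℝ → M) (Y : ∀ t, TangentSpace (𝓡 4) (σ t)) (t₀ : ℝ) : Prop :=
  ∀ (X : Fin 4 → VectorField M) (f : Fin 4 → ℝ → ℝ),
    (∀ i, IsSmoothVectorField (X i)) → (∀ i, DifferentiableAt ℝ (f i) t₀) →
    (∀ᶠ t in 𝓝 t₀, Y t = ∑ i, f i t • X i (σ t)) →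
    ∑ i, (deriv (f i) t₀ • X i (σ t₀)
      + f i t₀ • S.conn (X i) (σ t₀) (mfderiv 𝓘(ℝ, ℝ) (𝓡 4) σ t₀ (1 : ℝ))) = 0

end Spacetime

end Spacetime

/-! ### Spin structures and connections on them -/

section SpinStructure

variable {M : Type*} [TopologicalSpace M] [ChartedSpace (EuclideanSpace ℝ (Fin 4)) M]
  [IsManifold (𝓡 4) ∞ M]

/-- The structure of a smooth principal bundle over `M` with group `Spin^e_{1,3}` on the family of
fibres `P`, whose total space is a ten-dimensional manifold. In the local triviality condition,
`π⁻¹(U) ∋ S(x) u ↦ (x, u) ∈ U × Spin^e_{1,3}` is a diffeomorphism, `Spin^e_{1,3}` being regarded as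
a submanifold of `ℝ_{1,3}`: a map into `π⁻¹(U)` is smooth if and only if its two components are
smooth maps into `M` and into the vector space `ℝ_{1,3}`. -/
structure SpinBundle (P : M → Type*) [TopologicalSpace (TotalSpace Spin13 P)]
    [ChartedSpace (EuclideanSpace ℝ (Fin 10)) (TotalSpace Spin13 P)] where
  /-- the right action `p ↦ p u` -/
  act : ∀ {x : M}, P x → Spin13 → P x
  act_one : ∀ {x : M} (p : P x), act p 1 = p
  act_mul : ∀ {x : M} (p : P x) (u v : Spin13), act p (u * v) = act (act p u) v
  /-- the action is simply transitive on the fibres -/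
  act_simplyTransitive : ∀ {x : M} (p q : P x), ∃! u : Spin13, q = act p u
  proj_smooth : ContMDiff (𝓡 10) (𝓡 4) ∞ (TotalSpace.proj : TotalSpace Spin13 P → M)
  act_smooth : ∀ u : Spin13, ContMDiff (𝓡 10) (𝓡 10) ∞
    (fun p : TotalSpace Spin13 P => (⟨p.1, act p.2 u⟩ : TotalSpace Spin13 P))
  locallyTrivial : ∀ x₀ : M, ∃ U : Set M, IsOpen U ∧ x₀ ∈ U ∧ ∃ S : ∀ x, P x,
    ∀ (n : ℕ) (O : Set (EuclideanSpace ℝ (Fin n)))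
      (f : EuclideanSpace ℝ (Fin n) → TotalSpace Spin13 P), IsOpen O → (∀ y ∈ O, (f y).1 ∈ U) →
      (ContMDiffOn (𝓡 n) (𝓡 10) ∞ f O ↔
        ContMDiffOn (𝓡 n) (𝓡 4) ∞ (fun y => (f y).1) O ∧
        ∃ u : EuclideanSpace ℝ (Fin n) → Spin13, (∀ y ∈ O, (f y).2 = act (S (f y).1) (u y)) ∧
          ∀ I, ContDiffOn ℝ ∞ (fun y => multivectorBasis.repr ((u y : R13ˣ) : R13) I) O)

/-- A spin structure: a principal `Spin^e_{1,3}`-bundle with a smooth fibre preserving map `s` to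
the bundle of Lorentz frames such that `s(p u) = s(p) Ad_u`. -/
structure SpinStructure (S : Spacetime M) (P : M → Type*) [TopologicalSpace (TotalSpace Spin13 P)]
    [ChartedSpace (EuclideanSpace ℝ (Fin 10)) (TotalSpace Spin13 P)]
    [IsManifold (𝓡 10) ∞ (TotalSpace Spin13 P)] extends SpinBundle P where
  /-- the map `s` -/
  frame : ∀ {x : M}, P x → S.LorentzFrame x
  frame_smooth : ∀ a, ContMDiff (𝓡 10) (𝓡 4).tangent ∞
    (fun p : TotalSpace Spin13 P =>
      (⟨p.1, (frame p.2).iso (stdVec a)⟩ : TangentBundle (𝓡 4) M))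
  /-- `s(p u) = s(p) Ad_u`, as maps on `ℝ_{1,3}` -/
  frame_act : ∀ {x : M} (p : P x) (u : Spin13) (a : R13),
    CliffordAlgebra.equivOfIsometry (frame (act p u)).iso a =
      CliffordAlgebra.equivOfIsometry (frame p).iso
        (((u : R13ˣ) : R13) * a * (((u⁻¹ : Spin13) : R13ˣ) : R13))

namespace SpinStructure

variable {S : Spacetime M} {P : M → Type*} [TopologicalSpace (TotalSpace Spin13 P)]
  [ChartedSpace (EuclideanSpace ℝ (Fin 10)) (TotalSpace Spin13 P)]
  [IsManifold (𝓡 10) ∞ (TotalSpace Spin13 P)] (s : SpinStructure S P)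

/-- `s.cls p a` is the class `[(p, a)]` in `Cℓ(M, g) = P ×_Ad ℝ_{1,3}`: the isometry
`s(p) : ℝ^{1,3} → T_x M` induces an isomorphism of `ℝ_{1,3}` with `Cℓ(T_x M, g_x)`. -/
def cls {x : M} (p : P x) : R13 ≃ₐ[ℝ] S.Cl x := CliffordAlgebra.equivOfIsometry (s.frame p).iso

/-- The classes `[(p, a)]` are those of the associated bundle: `(p, a) ∼ (q, b)` if and only if
`q = p u⁻¹` and `b = u a u⁻¹` for some `u` in the spin group. -/
theorem cls_eq_iff {x : M} (p q : P x) (a b : R13) : s.cls p a = s.cls q b ↔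
    ∃ u : Spin13, q = s.act p u⁻¹ ∧
      b = ((u : R13ˣ) : R13) * a * (((u⁻¹ : Spin13) : R13ˣ) : R13) := by
  have key : ∀ u : Spin13, s.cls (s.act p u⁻¹)
      (((u : R13ˣ) : R13) * a * (((u⁻¹ : Spin13) : R13ˣ) : R13)) = s.cls p a := by
    intro u
    have h : ((u⁻¹ : Spin13) : R13ˣ) = ((u : R13ˣ))⁻¹ := rfl
    rw [cls, s.frame_act, inv_inv, cls, h]
    congr 1
    simp only [mul_assoc, Units.inv_mul, mul_one]
    rw [← mul_assoc, Units.inv_mul, one_mul]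
  constructor
  · intro h
    obtain ⟨u, hu, -⟩ := s.act_simplyTransitive p q
    refine ⟨u⁻¹, by rw [inv_inv]; exact hu, ?_⟩
    have hk := key u⁻¹
    rw [inv_inv, ← hu, h] at hk
    rw [inv_inv]
    exact ((s.cls q).injective hk).symm
  · rintro ⟨u, rfl, rfl⟩
    exact (key u).symm

/-- A spin frame: a smooth section of the spin bundle over the open set `U`. -/
def IsSpinFrameOn (Ξ : ∀ x, P x) (U : Set M) : Prop :=
  ContMDiffOn (𝓡 4) (𝓡 10) ∞ (fun x => (⟨x, Ξ x⟩ : TotalSpace Spin13 P)) U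

/-- The basis vector fields `e_a = [(Ξ, E_a)]`, as vector fields on `M`. -/
def e (Ξ : ∀ x, P x) (a : Fin 4) : VectorField M := fun x => (s.frame (Ξ x)).iso (stdVec a)

/-- The multivector basis sections `e_I = [(Ξ, E_I)]`. -/
def eI (Ξ : ∀ x, P x) (I : Finset (Fin 4)) (x : M) : S.Cl x := s.cls (Ξ x) (multivectorBasis I)

/-- The components `A^I` of a Clifford field, `A = ∑ A^I e_I`. -/
def comp (Ξ : ∀ x, P x) (A : ∀ x, S.Cl x) (I : Finset (Fin 4)) (x : M) : ℝ :=
  multivectorBasis.repr ((s.cls (Ξ x)).symm (A x)) I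

/-- `A` is a smooth section of the Clifford bundle: its components in the trivializations given
by local spin frames are smooth. -/
def IsSmoothCliffordField (A : ∀ x, S.Cl x) : Prop :=
  ∀ (U : Set M) (Ξ : ∀ x, P x), IsOpen U → IsSpinFrameOn Ξ U →
    ∀ I, ContMDiffOn (𝓡 4) 𝓘(ℝ, ℝ) ∞ (s.comp Ξ A I) U

theorem sum_comp_smul_eI (Ξ : ∀ x, P x) (A : ∀ x, S.Cl x) (x : M) :
    ∑ I, s.comp Ξ A I x • s.eI Ξ I x = A x := by
  have h := congrArg (s.cls (Ξ x)) (multivectorBasis.sum_repr ((s.cls (Ξ x)).symm (A x)))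
  rw [map_sum, AlgEquiv.apply_symm_apply] at h
  simpa only [map_smul, comp, eI] using h

/-- `V(A) = V(A^I) e_I`. -/
def dirDeriv (Ξ : ∀ x, P x) (V : VectorField M) (A : ∀ x, S.Cl x) (x : M) : S.Cl x :=
  ∑ I, mvfderiv (𝓡 4) (s.comp Ξ A I) x (V x) • s.eI Ξ I x

/-- The components `X^a` of a tangent vector in the frame `e_a`. -/
def vecComp (Ξ : ∀ x, P x) {x : M} (v : TangentSpace (𝓡 4) x) (a : Fin 4) : ℝ :=
  (s.frame (Ξ x)).iso.symm v a

/-- The connection coefficients `Γ_{ab}^c`, where `∇_{e_a} e_b = Γ_{ab}^c e_c`. -/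
def connCoeff (Ξ : ∀ x, P x) (a b c : Fin 4) (x : M) : ℝ :=
  s.vecComp Ξ (S.conn (s.e Ξ b) x (s.e Ξ a x)) c

/-- `Γ_{abc} = η_{cd} Γ_{ab}^d`, so that `∇_{e_a} e_b = Γ_{abc} e^c`. -/
def connCoeffLow (Ξ : ∀ x, P x) (a b c : Fin 4) (x : M) : ℝ := eta c * s.connCoeff Ξ a b c x

/-- The reciprocal basis `e^a = η^{ab} e_b`. -/
def eUp (Ξ : ∀ x, P x) (a : Fin 4) : VectorField M := fun x => eta a • s.e Ξ a x

theorem sum_vecComp_smul_e (Ξ : ∀ x, P x) {x : M} (v : TangentSpace (𝓡 4) x) :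
    ∑ a, s.vecComp Ξ v a • s.e Ξ a x = v := by
  have h : ∑ a, (s.frame (Ξ x)).iso.symm v a • stdVec a = (s.frame (Ξ x)).iso.symm v := by
    ext b
    simp [stdVec, Finset.sum_apply, Pi.single_apply]
  have h' := congrArg (s.frame (Ξ x)).iso.toLinearEquiv h
  rw [map_sum] at h'
  simp only [map_smul] at h'
  exact h'.trans ((s.frame (Ξ x)).iso.apply_symm_apply v)

/-- `∇_{e_a} e_b = Γ_{abc} e^c`. -/
theorem conn_e (Ξ : ∀ x, P x) (a b : Fin 4) (x : M) :
    S.conn (s.e Ξ b) x (s.e Ξ a x) = ∑ c, s.connCoeffLow Ξ a b c x • s.eUp Ξ c x := by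
  rw [← s.sum_vecComp_smul_e Ξ (S.conn (s.e Ξ b) x (s.e Ξ a x))]
  refine Finset.sum_congr rfl fun c _ => ?_
  rw [connCoeffLow, connCoeff, eUp, smul_smul]
  congr 1
  fin_cases c <;> simp [eta]

/-- The bivector `v ∧ w` as an element of the Clifford algebra. -/
def wedge {x : M} (v w : TangentSpace (𝓡 4) x) : S.Cl x :=
  (1 / 2 : ℝ) • (CliffordAlgebra.ι (S.quad x) v * CliffordAlgebra.ι (S.quad x) w
    - CliffordAlgebra.ι (S.quad x) w * CliffordAlgebra.ι (S.quad x) v)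

theorem wedge_eq {x : M} (v w : TangentSpace (𝓡 4) x) : wedge (S := S) v w =
    (CliffordAlgebra.equivExterior (S.quad x)).symm
      (ExteriorAlgebra.ι ℝ v * ExteriorAlgebra.ι ℝ w) := by
  rw [LinearEquiv.eq_symm_apply, wedge, CliffordAlgebra.equivExterior,
    CliffordAlgebra.changeFormEquiv_apply, map_smul, map_sub,
    CliffordAlgebra.changeForm_ι_mul_ι, CliffordAlgebra.changeForm_ι_mul_ι]
  have h : (ExteriorAlgebra.ι ℝ w * ExteriorAlgebra.ι ℝ v : ExteriorAlgebra ℝ _) =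
      -(ExteriorAlgebra.ι ℝ v * ExteriorAlgebra.ι ℝ w) :=
    eq_neg_of_add_eq_zero_left (ExteriorAlgebra.ι_add_mul_swap w v)
  have hs : QuadraticMap.associated (R := ℝ) (-S.quad x) v w =
      QuadraticMap.associated (R := ℝ) (-S.quad x) w v :=
    QuadraticMap.associated_isSymm ℝ (-S.quad x) v w
  rw [hs, h]
  change (1 / 2 : ℝ) • (ExteriorAlgebra.ι ℝ v * ExteriorAlgebra.ι ℝ w - _ - (_ - _)) = _
  rw [sub_sub_sub_cancel_right, sub_neg_eq_add, ← two_smul ℝ, smul_smul]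
  norm_num

/-- The connection bivector `ω_V = -½ V^a Γ_{abc} e^b ∧ e^c`. -/
def omega (Ξ : ∀ x, P x) (V : VectorField M) (x : M) : S.Cl x :=
  -(1 / 2 : ℝ) • ∑ a, ∑ b, ∑ c,
    (s.vecComp Ξ (V x) a * s.connCoeffLow Ξ a b c x) • wedge (s.eUp Ξ b x) (s.eUp Ξ c x)

/-- A smooth principal connection on the spin bundle, as a family of horizontal lifts
`Γ_p : T_x M → T_p P`. -/
structure Connection where
  lift : ∀ p : TotalSpace Spin13 P, TangentSpace (𝓡 4) p.1 →L[ℝ] TangentSpace (𝓡 10) p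
  proj_lift : ∀ (p : TotalSpace Spin13 P) (v : TangentSpace (𝓡 4) p.1),
    mfderiv (𝓡 10) (𝓡 4) (TotalSpace.proj : TotalSpace Spin13 P → M) p (lift p v) = v
  lift_act : ∀ (p : TotalSpace Spin13 P) (u : Spin13) (v : TangentSpace (𝓡 4) p.1),
    lift ⟨p.1, s.act p.2 u⟩ v =
      mfderiv (𝓡 10) (𝓡 10)
        (fun q : TotalSpace Spin13 P => (⟨q.1, s.act q.2 u⟩ : TotalSpace Spin13 P)) p (lift p v)
  lift_smooth : ∀ X : VectorField M, IsSmoothVectorField X →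
    ContMDiff (𝓡 10) (𝓡 10).tangent ∞
      (fun p => (⟨p, lift p (X p.1)⟩ : TangentBundle (𝓡 10) (TotalSpace Spin13 P)))

namespace Connection

variable {s} (Γ : s.Connection)

/-- The curve `p` in the spin bundle is parallel near `t₀`: `dp/dt = Γ_p(dσ/dt)`, where `σ` is its
projection to `M`. -/
def IsParallelNear (p : ℝ → TotalSpace Spin13 P) (t₀ : ℝ) : Prop :=
  ∀ᶠ t in 𝓝 t₀, HasMFDerivAt 𝓘(ℝ, ℝ) (𝓡 10) p t
    ((1 : ℝ →L[ℝ] ℝ).smulRight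
      (Γ.lift (p t) (mfderiv 𝓘(ℝ, ℝ) (𝓡 4) (fun t => (p t).1) t (1 : ℝ))))

/-- `Γ` is the spin connection of the spacetime, i.e. the lift of `∇` to the spin bundle: the map
`s` takes parallel curves of spin frames to curves of Lorentz frames that are parallel with respect
to `∇`. -/
def IsLift : Prop :=
  ∀ (p : ℝ → TotalSpace Spin13 P) (t₀ : ℝ), Γ.IsParallelNear p t₀ →
    ∀ a, S.IsParallelAt (fun t => (p t).1) (fun t => (s.frame (p t).2).iso (stdVec a)) t₀

end Connection

/-- The map `[(p, a)] ↦ [(q, a)]`. If `p` and `q` are two points of a parallel curve in the spin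
bundle, it is the parallel transport in `Cℓ(M, g) = P ×_Ad ℝ_{1,3}` along the projected curve. -/
def transport {x y : M} (p : P x) (q : P y) (A : S.Cl x) : S.Cl y := s.cls q ((s.cls p).symm A)

/-- `∇_V A = W`, where the covariant derivative of the Clifford field `A` is the limit of
`(A_{∥t}⁰ - A₀) / t` as `t → 0`, with `A_{∥t}⁰` the parallel transport of `A(σ(t))` from `σ(t)` to
`σ(0)` along a curve `σ` with velocity `V` at `t = 0`. The limit is taken for all such curves and
all their parallel lifts, and for each starting point there is one. Convergence in the
finite-dimensional fibre is tested on linear functionals. -/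
def Connection.IsCovDeriv {s : SpinStructure S P} (Γ : s.Connection) (V : VectorField M)
    (A W : ∀ x, S.Cl x) : Prop :=
  (∀ p₀ : TotalSpace Spin13 P, ∃ p : ℝ → TotalSpace Spin13 P, p 0 = p₀ ∧ Γ.IsParallelNear p 0 ∧
    mfderiv 𝓘(ℝ, ℝ) (𝓡 4) (fun t => (p t).1) 0 (1 : ℝ) = V (p 0).1) ∧
  ∀ p : ℝ → TotalSpace Spin13 P, Γ.IsParallelNear p 0 →
    mfderiv 𝓘(ℝ, ℝ) (𝓡 4) (fun t => (p t).1) 0 (1 : ℝ) = V (p 0).1 →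
    ∀ l : Module.Dual ℝ (S.Cl (p 0).1),
      Tendsto (fun t : ℝ => l (t⁻¹ • (s.transport (p t).2 (p 0).2 (A (p t).1) - A (p 0).1)))
        (𝓝[≠] 0) (𝓝 (l (W (p 0).1)))

end SpinStructure

end SpinStructure

end RiemannCartan

end

open RiemannCartan

/-! Let `p` be a parallel curve over `σ` and let `Ξ` be the spin frame. Each `s(p(t))` identifies
the fibre over `σ(t)` with the fixed algebra `R13`, and parallel transport leaves the element of
`R13` unchanged. So `∇_V A` is the derivative of `s(p(t))⁻¹ A(σ(t))`, carried back to the fibre over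
the starting point. With `A = A^I e_I`, the product rule splits it into the term `V(A^I) e_I` and
the derivatives of `s(p)⁻¹ e_I`; the latter have to produce `½[ω_V, ·]`.

On vectors this is linear algebra. `IsLift` makes the Lorentz frame `s(p)` parallel for `∇`, so
`s(p)⁻¹ e_b` has derivative `s(p)⁻¹ ∇_V e_b` (`hasDerivAt_frame_symm_e`). Since `∇g = 0`, the
coefficients `V^a Γ_{abc}` are skew in `b, c`, and a skew endomorphism of the tangent space is the
commutator with a bivector: `∇_V e_b = ½[ω_V, e_b]` (`omega_commutator_e`).

To pass to all multivectors, consider the algebra homomorphisms `ρ_t = s(p(t))⁻¹ ∘ s(Ξ(σ(t)))` of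
`R13`. Their derivative agrees on generators with `ρ` composed with an inner derivation. Both sides
obey the same Leibniz rule, so they agree everywhere (`hasWeakDerivAt_cliffordAlgebra_algHom`).
Parallel curves with the prescribed velocity are integral curves of the horizontal lift of `V`.

Derivatives are tested on linear functionals throughout, so no norm has to be chosen on a Clifford
algebra. -/

namespace RiemannCartan

/-! ### Derivatives of curves in finite-dimensional spaces, tested on linear functionals -/

section WeakDerivative

/-- The curve `f` in the vector space `W` has derivative `f'` at `t₀`, tested on linear
functionals. -/
def HasWeakDerivAt {W : Type*} [AddCommGroup W] [Module ℝ W] (f : ℝ → W) (f' : W) (t₀ : ℝ) : Prop :=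
  ∀ l : Module.Dual ℝ W, HasDerivAt (fun t => l (f t)) (l f') t₀

namespace HasWeakDerivAt

variable {W W' : Type*} [AddCommGroup W] [Module ℝ W] [AddCommGroup W'] [Module ℝ W']
  {f g : ℝ → W} {f' g' : W} {t₀ : ℝ}

theorem const (w : W) (t₀ : ℝ) : HasWeakDerivAt (fun _ => w) 0 t₀ := fun l => by
  simpa using hasDerivAt_const t₀ (l w)

theorem add (hf : HasWeakDerivAt f f' t₀) (hg : HasWeakDerivAt g g' t₀) :
    HasWeakDerivAt (fun t => f t + g t) (f' + g') t₀ := fun l => by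
  simpa only [map_add] using (hf l).fun_add (hg l)

theorem sum {ι : Type*} {s : Finset ι} {f : ι → ℝ → W} {f' : ι → W}
    (h : ∀ i ∈ s, HasWeakDerivAt (f i) (f' i) t₀) :
    HasWeakDerivAt (fun t => ∑ i ∈ s, f i t) (∑ i ∈ s, f' i) t₀ := fun l => by
  simpa only [map_sum] using HasDerivAt.fun_sum fun i hi => h i hi l

theorem smul {c : ℝ → ℝ} {c' : ℝ} (hc : HasDerivAt c c' t₀) (hf : HasWeakDerivAt f f' t₀) :
    HasWeakDerivAt (fun t => c t • f t) (c' • f t₀ + c t₀ • f') t₀ := fun l => by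
  simpa only [map_add, map_smul, smul_eq_mul] using hc.fun_mul (hf l)

theorem linear_comp (T : W →ₗ[ℝ] W') (hf : HasWeakDerivAt f f' t₀) :
    HasWeakDerivAt (fun t => T (f t)) (T f') t₀ := fun l => hf (l.comp T)

/-- Expanding the left factor in a finite basis turns the product into a sum of scalar functions
times fixed linear images of the right factor, to which `smul` and `linear_comp` apply. This is
where finite dimension enters. -/
theorem mul {A : Type*} [Ring A] [Algebra ℝ A] [Module.Finite ℝ A] {f g : ℝ → A} {f' g' : A}
    (hf : HasWeakDerivAt f f' t₀) (hg : HasWeakDerivAt g g' t₀) :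
    HasWeakDerivAt (fun t => f t * g t) (f' * g t₀ + f t₀ * g') t₀ := by
  have key : ∀ x y : A, ∑ i, (Module.finBasis ℝ A).coord i x • (Module.finBasis ℝ A i * y)
      = x * y := by
    intro x y
    conv_rhs => rw [← (Module.finBasis ℝ A).sum_repr x]
    simp only [Finset.sum_mul, smul_mul_assoc, Module.Basis.coord_apply]
  have h := HasWeakDerivAt.sum (s := Finset.univ) fun i _ =>
    HasWeakDerivAt.smul (hf ((Module.finBasis ℝ A).coord i))
      (hg.linear_comp (LinearMap.mulLeft ℝ (Module.finBasis ℝ A i)))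
  simpa only [LinearMap.mulLeft_apply, key, Finset.sum_add_distrib] using h

theorem pi {n : ℕ} {f : ℝ → Fin n → ℝ} {f' : Fin n → ℝ}
    (h : ∀ i, HasDerivAt (fun t => f t i) (f' i) t₀) : HasWeakDerivAt f f' t₀ := fun l => by
  have key : ∀ v : Fin n → ℝ, ∑ i, v i * l (Pi.single i 1) = l v := fun v => by
    conv_rhs => rw [← (Pi.basisFun ℝ (Fin n)).sum_repr v]
    simp
  simpa only [key] using
    HasDerivAt.fun_sum (u := Finset.univ) fun i _ => (h i).mul_const (l (Pi.single i 1))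

/-- The difference quotients converge to the weak derivative. -/
theorem tendsto_slope (hf : HasWeakDerivAt f f' t₀) (l : Module.Dual ℝ W) :
    Tendsto (fun t => l ((t - t₀)⁻¹ • (f t - f t₀))) (𝓝[≠] t₀) (𝓝 (l f')) := by
  have h := (hf l).tendsto_slope
  refine h.congr fun t => ?_
  simp [slope, map_sub, smul_eq_mul]

end HasWeakDerivAt

/-- A curve of algebra homomorphisms on a Clifford algebra whose derivative on basis vectors is an
inner derivation has this derivative on the whole algebra. -/
theorem hasWeakDerivAt_cliffordAlgebra_algHom {E : Type*} [AddCommGroup E] [Module ℝ E]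
    {ι : Type*} (b : Module.Basis ι ℝ E) {Q : QuadraticForm ℝ E} {A : Type*} [Ring A] [Algebra ℝ A] [Module.Finite ℝ A]
    {ρ : ℝ → CliffordAlgebra Q →ₐ[ℝ] A} {B : CliffordAlgebra Q} {t₀ : ℝ}
    (h : ∀ i, HasWeakDerivAt (fun t => ρ t (CliffordAlgebra.ι Q (b i)))
      (ρ t₀ (B * CliffordAlgebra.ι Q (b i) - CliffordAlgebra.ι Q (b i) * B)) t₀)
    (x : CliffordAlgebra Q) :
    HasWeakDerivAt (fun t => ρ t x) (ρ t₀ (B * x - x * B)) t₀ := by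
  have hadd : ∀ x y : CliffordAlgebra Q,
      HasWeakDerivAt (fun t => ρ t x) (ρ t₀ (B * x - x * B)) t₀ →
      HasWeakDerivAt (fun t => ρ t y) (ρ t₀ (B * y - y * B)) t₀ →
      HasWeakDerivAt (fun t => ρ t (x + y)) (ρ t₀ (B * (x + y) - (x + y) * B)) t₀ := by
    intro x y hx hy
    have hxy := hx.add hy
    simp only [← map_add] at hxy
    convert hxy using 2
    noncomm_ring
  induction x using CliffordAlgebra.induction with
  | algebraMap r =>
    -- Scalars are central and fixed by every `ρ t`, so both the derivative and the commutator
    -- vanish.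
    simp only [AlgHom.commutes, Algebra.commutes, sub_self, map_zero]
    exact .const _ _
  | ι v =>
    induction b.mem_span v using Submodule.span_induction with
    | mem v hv =>
      obtain ⟨i, rfl⟩ := hv
      exact h i
    | zero =>
      simp only [map_zero, mul_zero, zero_mul, sub_zero]
      exact .const _ _
    | add v w _ _ hv hw => simpa only [map_add] using hadd _ _ hv hw
    | smul c v _ hv =>
      have hc := hv.linear_comp (c • LinearMap.id)
      simp only [LinearMap.smul_apply, LinearMap.id_apply, ← map_smul, smul_sub] at hc
      simpa only [map_smul, mul_smul_comm, smul_mul_assoc] using hc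
  | mul x y hx hy =>
    -- Leibniz rule for the commutator: `[B, xy] = [B, x] y + x [B, y]`.
    have hxy := hx.mul hy
    simp only [← map_mul, ← map_add] at hxy
    convert hxy using 2
    noncomm_ring
  | add x y hx hy => exact hadd x y hx hy

instance : Module.Finite ℝ R13 := Module.Finite.of_basis multivectorBasis

end WeakDerivative

/-! ### Lorentz frames -/

theorem eta_mul_self (a : Fin 4) : eta a * eta a = 1 := by fin_cases a <;> simp [eta]

section Frames

variable {M : Type*} [TopologicalSpace M] [ChartedSpace (EuclideanSpace ℝ (Fin 4)) M]
  [IsManifold (𝓡 4) ∞ M] (S : Spacetime M)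

namespace Spacetime

theorem quad_apply (x : M) (v : TangentSpace (𝓡 4) x) : S.quad x v = S.metric x v v := rfl

/-- Polarization: the isometry is only known to preserve the quadratic forms, and symmetry of the
metric recovers the bilinear form from its values on `v + w`, `v` and `w`. -/
theorem metric_isometry {x : M} (f : Q13.IsometryEquiv (S.quad x)) (v w : Fin 4 → ℝ) :
    S.metric x (f v) (f w) = ∑ i, eta i * (v i * w i) := by
  have h : ∀ u, S.metric x (f u) (f u) = ∑ i, eta i * (u i * u i) := fun u => by
    rw [← S.quad_apply, f.map_app, Q13, QuadraticMap.weightedSumSquares_apply]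
    rfl
  have h1 := h (v + w)
  have hadd : f (v + w) = f v + f w := map_add f.toLinearEquiv v w
  rw [hadd] at h1
  simp only [map_add, add_apply, h, S.metric_symm x (f w) (f v), Pi.add_apply, mul_add,
    add_mul, Finset.sum_add_distrib] at h1
  have h2 : ∑ i, eta i * (w i * v i) = ∑ i, eta i * (v i * w i) := by simp only [mul_comm (v _)]
  linarith

theorem metric_isometry_stdVec {x : M} (f : Q13.IsometryEquiv (S.quad x)) (a b : Fin 4) :
    S.metric x (f (stdVec a)) (f (stdVec b)) = if a = b then eta a else 0 := by
  rw [S.metric_isometry]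
  rcases eq_or_ne a b with rfl | h
  · simp [stdVec, Pi.single_apply]
  · simp [stdVec, Pi.single_apply, h, h.symm]

/-- The components of a vector in an orthonormal frame. -/
theorem isometry_symm_apply {x : M} (f : Q13.IsometryEquiv (S.quad x)) (v : TangentSpace (𝓡 4) x)
    (a : Fin 4) : f.symm v a = eta a * S.metric x (f (stdVec a)) v := by
  have h := S.metric_isometry f (stdVec a) (f.symm v)
  rw [f.apply_symm_apply] at h
  rw [h]
  simp [stdVec, Pi.single_apply, ← mul_assoc, eta_mul_self]

/-- The commutator of a bivector and a vector. -/
theorem wedge_commutator {x : M} (u v w : TangentSpace (𝓡 4) x) :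
    SpinStructure.wedge (S := S) u v * CliffordAlgebra.ι (S.quad x) w
      - CliffordAlgebra.ι (S.quad x) w * SpinStructure.wedge (S := S) u v
    = (2 * S.metric x v w) • CliffordAlgebra.ι (S.quad x) u
      - (2 * S.metric x u w) • CliffordAlgebra.ι (S.quad x) v := by
  have hswap : ∀ a b : TangentSpace (𝓡 4) x,
      CliffordAlgebra.ι (S.quad x) a * CliffordAlgebra.ι (S.quad x) b =
        algebraMap ℝ _ (2 * S.metric x a b)
          - CliffordAlgebra.ι (S.quad x) b * CliffordAlgebra.ι (S.quad x) a := fun a b => by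
    rw [eq_sub_iff_add_eq, CliffordAlgebra.ι_mul_ι_add_swap]
    congr 1
    simp only [QuadraticMap.polar, quad_apply, map_add, add_apply, S.metric_symm x b a]
    ring
  -- Anticommuting `c` past `b` and then past `a` restores the product `c a b`; only the two scalar
  -- terms remain.
  have hmul : ∀ a b c : TangentSpace (𝓡 4) x,
      CliffordAlgebra.ι (S.quad x) a * CliffordAlgebra.ι (S.quad x) b
          * CliffordAlgebra.ι (S.quad x) c
        - CliffordAlgebra.ι (S.quad x) c
          * (CliffordAlgebra.ι (S.quad x) a * CliffordAlgebra.ι (S.quad x) b)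
      = (2 * S.metric x b c) • CliffordAlgebra.ι (S.quad x) a
        - (2 * S.metric x a c) • CliffordAlgebra.ι (S.quad x) b := fun a b c => by
    rw [mul_assoc, hswap b c, mul_sub, ← mul_assoc, ← mul_assoc, hswap a c, sub_mul,
      ← Algebra.commutes, Algebra.smul_def, Algebra.smul_def]
    abel
  rw [SpinStructure.wedge, smul_mul_assoc, mul_smul_comm, ← smul_sub, sub_mul, mul_sub,
    sub_sub_sub_comm, hmul, hmul]
  module

end Spacetime

end Frames

/-! ### Moving spin frames and the connection bivector -/

section SpinConnection

variable {M : Type*} [TopologicalSpace M] [ChartedSpace (EuclideanSpace ℝ (Fin 4)) M]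
  [IsManifold (𝓡 4) ∞ M] {S : Spacetime M}
  {P : M → Type*} [TopologicalSpace (TotalSpace Spin13 P)]
  [ChartedSpace (EuclideanSpace ℝ (Fin 10)) (TotalSpace Spin13 P)]
  [IsManifold (𝓡 10) ∞ (TotalSpace Spin13 P)] (s : SpinStructure S P)

namespace SpinStructure

variable {Ξ : ∀ x, P x}

theorem isSmoothVectorField_e (hΞ : IsSpinFrameOn Ξ Set.univ) (a : Fin 4) :
    IsSmoothVectorField (s.e Ξ a) :=
  (s.frame_smooth a).comp (contMDiffOn_univ.1 hΞ)

/-- The scalar products of the vectors of a moving frame with those of the frame of a point of the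
spin bundle are smooth functions on the spin bundle. -/
theorem contMDiff_metric_e_frame (hΞ : IsSpinFrameOn Ξ Set.univ) (a b : Fin 4) :
    ContMDiff (𝓡 10) 𝓘(ℝ, ℝ) ∞ (fun p : TotalSpace Spin13 P =>
      S.metric p.1 (s.e Ξ b p.1) ((s.frame p.2).iso (stdVec a))) := by
  have h := ContMDiff.clm_bundle_apply₂ (F₁ := EuclideanSpace ℝ (Fin 4))
    (E₁ := (TangentSpace (𝓡 4) : M → Type _)) (F₂ := EuclideanSpace ℝ (Fin 4))
    (E₂ := (TangentSpace (𝓡 4) : M → Type _)) (F₃ := ℝ) (E₃ := Bundle.Trivial M ℝ)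
    (b := fun p : TotalSpace Spin13 P => p.1)
    (ψ := fun p => S.metric p.1) (v := fun p => s.e Ξ b p.1)
    (w := fun p => (s.frame p.2).iso (stdVec a))
    (S.metric_smooth.comp s.proj_smooth)
    ((s.isSmoothVectorField_e hΞ b).comp s.proj_smooth) (s.frame_smooth a)
  intro p
  -- The pairing takes values in the trivial line bundle, whose fibre coordinate is the scalar
  -- function itself.
  exact (contMDiffAt_totalSpace.1 (h p)).2

/-- The connection coefficients of a metric connection are skew: `Γ_{abc} = -Γ_{acb}`. -/
theorem eta_mul_vecComp_conn (hΞ : IsSpinFrameOn Ξ Set.univ) (x : M) (v : TangentSpace (𝓡 4) x)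
    (b c : Fin 4) : eta c * s.vecComp Ξ (S.conn (s.e Ξ b) x v) c =
      -(eta b * s.vecComp Ξ (S.conn (s.e Ξ c) x v) b) := by
  have h := S.conn_metric _ _ (s.isSmoothVectorField_e hΞ b) (s.isSmoothVectorField_e hΞ c) x v
  -- The frame is orthonormal at every point, so its scalar products are constant and `∇g = 0`
  -- equates the sum of the two connection terms to zero.
  have hconst : (fun y => S.metric y (s.e Ξ b y) (s.e Ξ c y)) = fun _ => if b = c then eta b else 0 :=
    funext fun y => S.metric_isometry_stdVec _ b c
  rw [hconst, mvfderiv_const] at h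
  simp only [vecComp, S.isometry_symm_apply, ← mul_assoc, eta_mul_self, one_mul]
  change S.metric x (s.e Ξ c x) _ = -S.metric x (s.e Ξ b x) _
  rw [S.metric_symm x (s.e Ξ c x)]
  exact eq_neg_of_add_eq_zero_left h.symm

/-- Linearity of `∇_v` in `v`; it identifies the sums over `a` in `omega` with components of `∇_V
e_b`. -/
theorem vecComp_conn (x : M) (v : TangentSpace (𝓡 4) x) (b c : Fin 4) :
    s.vecComp Ξ (S.conn (s.e Ξ b) x v) c = ∑ a, s.vecComp Ξ v a * s.connCoeff Ξ a b c x := by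
  conv_lhs => rw [← s.sum_vecComp_smul_e Ξ v, map_sum]
  simp only [connCoeff, vecComp, S.isometry_symm_apply, map_sum, map_smul, smul_eq_mul,
    Finset.mul_sum]
  exact Finset.sum_congr rfl fun a _ => by ring

/-- `½ [ω_V, e_d] = ∇_V e_d`. -/
theorem omega_commutator_e (hΞ : IsSpinFrameOn Ξ Set.univ) (V : VectorField M) (x : M)
    (d : Fin 4) :
    (1 / 2 : ℝ) • (s.omega Ξ V x * CliffordAlgebra.ι (S.quad x) (s.e Ξ d x)
      - CliffordAlgebra.ι (S.quad x) (s.e Ξ d x) * s.omega Ξ V x)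
    = CliffordAlgebra.ι (S.quad x) (S.conn (s.e Ξ d) x (V x)) := by
  -- `G b c` is `V^a Γ_{abc}`, the lowered component of `∇_V e_b`.
  set G : Fin 4 → Fin 4 → ℝ := fun b c => eta c * s.vecComp Ξ (S.conn (s.e Ξ b) x (V x)) c with hG
  have hskew : ∀ b c, G b c = -G c b := s.eta_mul_vecComp_conn hΞ x (V x)
  have hω : s.omega Ξ V x
      = -(1 / 2 : ℝ) • ∑ b, ∑ c, G b c • wedge (S := S) (s.eUp Ξ b x) (s.eUp Ξ c x) := by
    rw [omega, Finset.sum_comm]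
    congr 1
    refine Finset.sum_congr rfl fun b _ => ?_
    rw [Finset.sum_comm]
    refine Finset.sum_congr rfl fun c _ => ?_
    rw [← Finset.sum_smul]
    congr 1
    simp only [hG, s.vecComp_conn, connCoeffLow, Finset.mul_sum]
    exact Finset.sum_congr rfl fun a _ => by ring
  have hpair : ∀ b, S.metric x (s.eUp Ξ b x) (s.e Ξ d x) = if b = d then 1 else 0 := fun b => by
    rw [eUp, map_smul, smul_apply, e, e, S.metric_isometry_stdVec]
    split_ifs <;> simp [eta_mul_self]
  have hconn : S.conn (s.e Ξ d) x (V x) = ∑ c, G d c • s.eUp Ξ c x := by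
    conv_lhs => rw [← s.sum_vecComp_smul_e Ξ (S.conn (s.e Ξ d) x (V x))]
    refine Finset.sum_congr rfl fun c _ => ?_
    rw [eUp, smul_smul, hG]
    congr 1
    rw [mul_right_comm, eta_mul_self, one_mul]
  rw [hω, smul_mul_assoc, mul_smul_comm, ← smul_sub, Finset.sum_mul, Finset.mul_sum,
    ← Finset.sum_sub_distrib]
  simp only [Finset.sum_mul, Finset.mul_sum, ← Finset.sum_sub_distrib, smul_mul_assoc,
    mul_smul_comm, ← smul_sub, S.wedge_commutator, hpair]
  simp only [smul_sub, Finset.sum_sub_distrib, mul_ite, mul_one, mul_zero, ite_smul, zero_smul,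
    smul_ite, smul_zero, Finset.sum_ite_eq', Finset.mem_univ, if_true]
  rw [Finset.sum_comm]
  simp only [Finset.sum_ite_eq', Finset.mem_univ, if_true]
  rw [hconn, map_sum]
  simp only [Finset.smul_sum]
  rw [← Finset.sum_sub_distrib]
  refine Finset.sum_congr rfl fun c _ => ?_
  -- The two terms of the bivector commutator contribute equally by skewness, which cancels the
  -- factors `½` in `omega` and in the statement.
  rw [hskew c d, map_smul]
  module

end SpinStructure

end SpinConnection

/-! ### Parallel transport in the Clifford bundle -/

section ParallelTransport

variable {M : Type*} [TopologicalSpace M] [ChartedSpace (EuclideanSpace ℝ (Fin 4)) M]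
  [IsManifold (𝓡 4) ∞ M] {S : Spacetime M}
  {P : M → Type*} [TopologicalSpace (TotalSpace Spin13 P)]
  [ChartedSpace (EuclideanSpace ℝ (Fin 10)) (TotalSpace Spin13 P)]
  [IsManifold (𝓡 10) ∞ (TotalSpace Spin13 P)] {s : SpinStructure S P}

namespace SpinStructure.Connection

variable (Γ : s.Connection) {Ξ : ∀ x, P x} {p : ℝ → TotalSpace Spin13 P} {t₀ : ℝ}

/-- Integral curves of the horizontal lift of a vector field are parallel. -/
theorem exists_isParallelNear {V : VectorField M} (hV : IsSmoothVectorField V)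
    (p₀ : TotalSpace Spin13 P) :
    ∃ p : ℝ → TotalSpace Spin13 P, p t₀ = p₀ ∧ Γ.IsParallelNear p t₀ ∧
      mfderiv 𝓘(ℝ, ℝ) (𝓡 4) (fun t => (p t).1) t₀ (1 : ℝ) = V (p t₀).1 := by
  -- The horizontal field `q ↦ Γ_q(V)` is smooth on the total space. As `Γ_q` is a right inverse of
  -- the differential of the projection, its integral curves project to curves with velocity `V`, as
  -- `hσ` records.
  obtain ⟨p, hp₀, hp⟩ := exists_isMIntegralCurveAt_of_contMDiffAt_boundaryless (I := 𝓡 10)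
    (v := fun q : TotalSpace Spin13 P => Γ.lift q (V q.1)) (x₀ := p₀) t₀
    (((Γ.lift_smooth V hV) p₀).of_le (by simp))
  have hσ : ∀ t, HasMFDerivAt 𝓘(ℝ, ℝ) (𝓡 10) p t
      ((1 : ℝ →L[ℝ] ℝ).smulRight (Γ.lift (p t) (V (p t).1))) →
      mfderiv 𝓘(ℝ, ℝ) (𝓡 4) (fun t => (p t).1) t (1 : ℝ) = V (p t).1 := fun t ht => by
    have hπ : MDifferentiableAt (𝓡 10) (𝓡 4) (TotalSpace.proj : TotalSpace Spin13 P → M) (p t) :=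
      (s.proj_smooth (p t)).mdifferentiableAt (by simp)
    have h := (hπ.hasMFDerivAt.comp t ht).mfderiv
    refine (congrArg (fun L => L (1 : ℝ)) h).trans ?_
    change mfderiv (𝓡 10) (𝓡 4) (TotalSpace.proj : TotalSpace Spin13 P → M) (p t)
      ((1 : ℝ) • Γ.lift (p t) (V (p t).1)) = _
    rw [one_smul, Γ.proj_lift]
  refine ⟨p, hp₀, ?_, hσ t₀ hp.self_of_nhds⟩
  filter_upwards [hp] with t ht
  rw [hσ t ht]
  exact ht

variable {Γ}

theorem IsParallelNear.mdifferentiableAt (hp : Γ.IsParallelNear p t₀) :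
    MDifferentiableAt 𝓘(ℝ, ℝ) (𝓡 10) p t₀ :=
  (Filter.Eventually.self_of_nhds hp).mdifferentiableAt

theorem IsParallelNear.mdifferentiableAt_proj (hp : Γ.IsParallelNear p t₀) :
    MDifferentiableAt 𝓘(ℝ, ℝ) (𝓡 4) (fun t => (p t).1) t₀ :=
  MDifferentiableAt.comp t₀ ((s.proj_smooth (p t₀)).mdifferentiableAt (by simp))
    hp.mdifferentiableAt

/-- The derivative of the components of a parallel Lorentz frame in a moving frame. -/
theorem IsParallelNear.hasDerivAt_vecComp (hΓ : Γ.IsLift) (hΞ : IsSpinFrameOn Ξ Set.univ)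
    (hp : Γ.IsParallelNear p t₀) (a b : Fin 4) :
    HasDerivAt (fun t => s.vecComp Ξ ((s.frame (p t).2).iso (stdVec a)) b)
      (-∑ c, s.vecComp Ξ ((s.frame (p t₀).2).iso (stdVec a)) c *
        s.vecComp Ξ (S.conn (s.e Ξ c) (p t₀).1
          (mfderiv 𝓘(ℝ, ℝ) (𝓡 4) (fun t => (p t).1) t₀ (1 : ℝ))) b) t₀ := by
  set f : Fin 4 → ℝ → ℝ := fun c t => s.vecComp Ξ ((s.frame (p t).2).iso (stdVec a)) c with hf
  have hd : ∀ c, DifferentiableAt ℝ (f c) t₀ := fun c => by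
    have h := (((s.contMDiff_metric_e_frame hΞ a c) (p t₀)).mdifferentiableAt (by simp)).comp t₀
      hp.mdifferentiableAt
    have hfc : f c = fun t => eta c *
        S.metric (p t).1 (s.e Ξ c (p t).1) ((s.frame (p t).2).iso (stdVec a)) :=
      funext fun t => S.isometry_symm_apply _ _ c
    rw [hfc]
    exact (mdifferentiableAt_iff_differentiableAt.1 h).const_mul (eta c)
  -- The parallelism condition is evaluated on the expansion of the frame vector in the fields
  -- `e_c`; its component along `e_b` is the claim.
  have h := hΓ p t₀ hp a (s.e Ξ) f (fun c => s.isSmoothVectorField_e hΞ c) hd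
    (Filter.Eventually.of_forall fun t => (s.sum_vecComp_smul_e Ξ _).symm)
  have hb := congrArg (fun v : TangentSpace (𝓡 4) (p t₀).1 => s.vecComp Ξ v b) h
  have hee : ∀ c, s.vecComp Ξ (s.e Ξ c (p t₀).1) b = if b = c then 1 else 0 := fun c => by
    rw [vecComp, S.isometry_symm_apply, e, S.metric_isometry_stdVec]
    split_ifs <;> simp [eta_mul_self]
  have hlin : ∀ (v w : TangentSpace (𝓡 4) (p t₀).1), s.vecComp Ξ (v + w) b
      = s.vecComp Ξ v b + s.vecComp Ξ w b := fun v w => by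
    simp only [vecComp, S.isometry_symm_apply, map_add, mul_add]
  have hsmul : ∀ (r : ℝ) (v : TangentSpace (𝓡 4) (p t₀).1), s.vecComp Ξ (r • v) b
      = r * s.vecComp Ξ v b := fun r v => by
    simp only [vecComp, S.isometry_symm_apply, map_smul, smul_eq_mul]
    ring
  have hzero : s.vecComp Ξ (0 : TangentSpace (𝓡 4) (p t₀).1) b = 0 := by
    simp only [vecComp, S.isometry_symm_apply, map_zero, mul_zero]
  have hsum : ∀ v : Fin 4 → TangentSpace (𝓡 4) (p t₀).1, s.vecComp Ξ (∑ c, v c) b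
      = ∑ c, s.vecComp Ξ (v c) b := fun v => by
    simp only [vecComp, S.isometry_symm_apply, map_sum, Finset.mul_sum]
  simp only [hsum, hlin, hsmul, hzero, hee, Finset.sum_add_distrib, mul_ite, mul_one, mul_zero,
    Finset.sum_ite_eq, Finset.mem_univ, if_true] at hb
  rw [← eq_neg_of_add_eq_zero_left hb]
  exact (hd b).hasDerivAt

/-- The components `s(p)⁻¹ e_b` of a moving frame with respect to a parallel Lorentz frame have
the derivative `s(p)⁻¹ ∇ e_b`. -/
theorem IsParallelNear.hasDerivAt_frame_symm_e (hΓ : Γ.IsLift) (hΞ : IsSpinFrameOn Ξ Set.univ)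
    (hp : Γ.IsParallelNear p t₀) (a b : Fin 4) :
    HasDerivAt (fun t => (s.frame (p t).2).iso.symm (s.e Ξ b (p t).1) a)
      ((s.frame (p t₀).2).iso.symm (S.conn (s.e Ξ b) (p t₀).1
          (mfderiv 𝓘(ℝ, ℝ) (𝓡 4) (fun t => (p t).1) t₀ (1 : ℝ))) a) t₀ := by
  -- Between orthonormal frames the inverse transition matrix is the transpose up to signs, so no
  -- matrix inverse has to be differentiated.
  have hrel : ∀ (c : Fin 4) (t : ℝ), (s.frame (p t).2).iso.symm (s.e Ξ c (p t).1) a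
      = eta a * eta c * s.vecComp Ξ ((s.frame (p t).2).iso (stdVec a)) c := fun c t => by
    rw [vecComp, S.isometry_symm_apply, S.isometry_symm_apply, S.metric_symm, mul_assoc,
      ← mul_assoc (eta c), eta_mul_self, one_mul]
    rfl
  have h := (hp.hasDerivAt_vecComp hΓ hΞ a b).const_mul (eta a * eta b)
  simp only [← hrel] at h
  refine h.congr_deriv (Eq.symm ?_)
  set v := mfderiv 𝓘(ℝ, ℝ) (𝓡 4) (fun t => (p t).1) t₀ (1 : ℝ)
  have hexp := s.sum_vecComp_smul_e Ξ (S.conn (s.e Ξ b) (p t₀).1 v)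
  conv_lhs => rw [← hexp]
  rw [S.isometry_symm_apply, map_sum, Finset.mul_sum, ← Finset.sum_neg_distrib, Finset.mul_sum]
  refine Finset.sum_congr rfl fun c _ => ?_
  rw [map_smul, smul_eq_mul, mul_left_comm, ← S.isometry_symm_apply, hrel]
  have hskew := s.eta_mul_vecComp_conn hΞ (p t₀).1 v b c
  linear_combination (eta a * s.vecComp Ξ ((s.frame (p t₀).2).iso (stdVec a)) c) * hskew

/-- The parallel transport of the multivectors with constant components in a moving frame is
generated by `½ ω`. -/
theorem IsParallelNear.hasWeakDerivAt_cls (hΓ : Γ.IsLift) (hΞ : IsSpinFrameOn Ξ Set.univ)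
    (hp : Γ.IsParallelNear p t₀) {V : VectorField M}
    (hV : mfderiv 𝓘(ℝ, ℝ) (𝓡 4) (fun t => (p t).1) t₀ (1 : ℝ) = V (p t₀).1) (x : R13) :
    HasWeakDerivAt (fun t => (s.cls (p t).2).symm (s.cls (Ξ (p t).1) x))
      ((s.cls (p t₀).2).symm ((1 / 2 : ℝ) • (s.omega Ξ V (p t₀).1 * s.cls (Ξ (p t₀).1) x
        - s.cls (Ξ (p t₀).1) x * s.omega Ξ V (p t₀).1))) t₀ := by
  set ρ : ℝ → R13 →ₐ[ℝ] R13 := fun t =>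
    ((s.cls (Ξ (p t).1)).trans (s.cls (p t).2).symm : R13 ≃ₐ[ℝ] R13) with hρ
  -- The bivector `½ ω_V` at time `t₀`, read in the moving frame, so that `ρ t₀` carries `[B, x]` to
  -- the required commutator.
  set B : R13 := (s.cls (Ξ (p t₀).1)).symm ((1 / 2 : ℝ) • s.omega Ξ V (p t₀).1) with hB
  have hcls : ∀ {x : M} (q : P x) (v : Fin 4 → ℝ), s.cls q (CliffordAlgebra.ι Q13 v)
      = CliffordAlgebra.ι (S.quad x) ((s.frame q).iso v) := fun q v =>
    CliffordAlgebra.map_apply_ι _ _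
  have hcls' : ∀ {x : M} (q : P x) (v : TangentSpace (𝓡 4) x),
      (s.cls q).symm (CliffordAlgebra.ι (S.quad x) v)
      = CliffordAlgebra.ι Q13 ((s.frame q).iso.symm v) := fun q v => by
    rw [AlgEquiv.symm_apply_eq, hcls, QuadraticMap.IsometryEquiv.apply_symm_apply]
  have hcomm : ∀ x : R13, ρ t₀ (B * x - x * B) =
      (s.cls (p t₀).2).symm ((1 / 2 : ℝ) • (s.omega Ξ V (p t₀).1 * s.cls (Ξ (p t₀).1) x
        - s.cls (Ξ (p t₀).1) x * s.omega Ξ V (p t₀).1)) := fun x => by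
    change (s.cls (p t₀).2).symm (s.cls (Ξ (p t₀).1) (B * x - x * B)) = _
    rw [map_sub, map_mul, map_mul, hB, AlgEquiv.apply_symm_apply, smul_mul_assoc, mul_smul_comm,
      ← smul_sub]
  rw [← hcomm]
  have hE : ∀ d, HasWeakDerivAt (fun t => ρ t (CliffordAlgebra.ι Q13 (stdVec d)))
      (ρ t₀ (B * CliffordAlgebra.ι Q13 (stdVec d) - CliffordAlgebra.ι Q13 (stdVec d) * B)) t₀ := by
    intro d
    have h := (HasWeakDerivAt.pi fun a => hp.hasDerivAt_frame_symm_e hΓ hΞ a d).linear_comp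
      (CliffordAlgebra.ι Q13)
    simp only [← hcls'] at h
    rw [hV, ← s.omega_commutator_e hΞ] at h
    rw [hcomm, hcls]
    refine Eq.mp (congrArg (fun g => HasWeakDerivAt g _ t₀) (funext fun t => ?_)) h
    exact congrArg (s.cls (p t).2).symm (hcls _ _).symm
  refine hasWeakDerivAt_cliffordAlgebra_algHom (Pi.basisFun ℝ (Fin 4)) (ρ := ρ) (fun d => ?_) x
  rw [Pi.basisFun_apply]
  exact hE d

/-- The derivative of a Clifford field, transported parallelly to the starting point. -/
theorem IsParallelNear.hasWeakDerivAt_transport (hΓ : Γ.IsLift) (hΞ : IsSpinFrameOn Ξ Set.univ)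
    (hp : Γ.IsParallelNear p t₀) {V : VectorField M}
    (hV : mfderiv 𝓘(ℝ, ℝ) (𝓡 4) (fun t => (p t).1) t₀ (1 : ℝ) = V (p t₀).1)
    {A : ∀ x, S.Cl x} (hA : s.IsSmoothCliffordField A) :
    HasWeakDerivAt (fun t => s.transport (p t).2 (p t₀).2 (A (p t).1))
      (s.dirDeriv Ξ V A (p t₀).1 + (1 / 2 : ℝ) • (s.omega Ξ V (p t₀).1 * A (p t₀).1
        - A (p t₀).1 * s.omega Ξ V (p t₀).1)) t₀ := by
  have hcomp : ∀ I, HasDerivAt (fun t => s.comp Ξ A I (p t).1)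
      (mvfderiv (𝓡 4) (s.comp Ξ A I) (p t₀).1 (V (p t₀).1)) t₀ := fun I => by
    have hAI : MDifferentiableAt (𝓡 4) 𝓘(ℝ, ℝ) (s.comp Ξ A I) (p t₀).1 :=
      (contMDiffOn_univ.1 (hA Set.univ Ξ isOpen_univ hΞ I) _).mdifferentiableAt (by simp)
    have h : HasFDerivAt (fun t => s.comp Ξ A I (p t).1)
        (show ℝ →L[ℝ] ℝ from (mfderiv (𝓡 4) 𝓘(ℝ, ℝ) (s.comp Ξ A I) (p t₀).1).comp
          (mfderiv 𝓘(ℝ, ℝ) (𝓡 4) (fun t => (p t).1) t₀)) t₀ :=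
      hasMFDerivAt_iff_hasFDerivAt.1
        (hAI.hasMFDerivAt.comp t₀ hp.mdifferentiableAt_proj.hasMFDerivAt)
    rw [← hV]
    exact h.hasDerivAt
  -- The product rule is applied in the fixed space `R13`; the fixed map `s(p(t₀))` then carries the
  -- result to the fibre over the starting point.
  have h := (HasWeakDerivAt.sum (s := Finset.univ) fun I _ => HasWeakDerivAt.smul (hcomp I)
    (hp.hasWeakDerivAt_cls hΓ hΞ hV (multivectorBasis I))).linear_comp
      (s.cls (p t₀).2).toLinearEquiv.toLinearMap
  have hfun : ∀ t, (s.cls (p t₀).2).toLinearEquiv.toLinearMap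
      (∑ I, s.comp Ξ A I (p t).1 • (s.cls (p t).2).symm (s.cls (Ξ (p t).1) (multivectorBasis I)))
      = s.transport (p t).2 (p t₀).2 (A (p t).1) := fun t => by
    refine congrArg (s.cls (p t₀).2) ?_
    conv_rhs => rw [← s.sum_comp_smul_eI Ξ A (p t).1, map_sum]
    simp only [map_smul]
    rfl
  simp only [hfun] at h
  convert h using 1
  simp only [← map_smul, ← map_add, ← map_sum]
  refine Eq.trans ?_ ((s.cls (p t₀).2).apply_symm_apply _).symm
  rw [Finset.sum_add_distrib]
  refine congrArg₂ (· + ·) (Finset.sum_congr rfl fun I _ => (map_smul (s.cls _) _ _).symm) ?_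
  conv_lhs => rw [← s.sum_comp_smul_eI Ξ A (p t₀).1]
  rw [Finset.mul_sum, Finset.sum_mul, ← Finset.sum_sub_distrib, Finset.smul_sum]
  refine Finset.sum_congr rfl fun I _ => ?_
  rw [mul_smul_comm, smul_mul_assoc, ← smul_sub, smul_comm]
  rfl

end SpinStructure.Connection

end ParallelTransport

end RiemannCartan

open RiemannCartan
theorem mainTheorem1 {M : Type*} [TopologicalSpace M] [T2Space M] [ParacompactSpace M]
    [ConnectedSpace M] [NoncompactSpace M]
    [ChartedSpace (EuclideanSpace ℝ (Fin 4)) M] [IsManifold (𝓡 4) ∞ M]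
    (S : Spacetime M)
    {P : M → Type*} [TopologicalSpace (TotalSpace Spin13 P)]
    [ChartedSpace (EuclideanSpace ℝ (Fin 10)) (TotalSpace Spin13 P)]
    [IsManifold (𝓡 10) ∞ (TotalSpace Spin13 P)]
    (s : SpinStructure S P) (Γ : s.Connection) (hΓ : Γ.IsLift)
    (Ξ : ∀ x, P x) (hΞ : SpinStructure.IsSpinFrameOn Ξ Set.univ)
    (V : VectorField M) (hV : IsSmoothVectorField V)
    (A : ∀ x, S.Cl x) (hA : s.IsSmoothCliffordField A) :
    Γ.IsCovDeriv V A (fun x => s.dirDeriv Ξ V A x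
      + (1 / 2 : ℝ) • (s.omega Ξ V x * A x - A x * s.omega Ξ V x)) := by
  refine ⟨fun p₀ => Γ.exists_isParallelNear hV p₀, fun p hp hpV l => ?_⟩
  have h := (hp.hasWeakDerivAt_transport hΓ hΞ hpV hA).tendsto_slope l
  -- At `t = 0` the transport is the identity, so the slope of the transported field is the required
  -- difference quotient.
  simpa only [sub_zero, SpinStructure.transport, AlgEquiv.apply_symm_apply] using h
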